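/- For a prime $p$, let $\mathsf{Line}_p$ be the class of functions $f:\mathbb{Z}_p^2\to\{0,1\}$ for which there are $a,b\in\mathbb{Z}_p$ such that, for all $x,y\in\mathbb{Z}_p$, $f(x,y)=1$ if and only if $ax+b=y$. A learner with $n$ samples is a randomized map $A$ from $(\mathbb{Z}_p^2\times\{0,1\})^n$ to functions $\mathbb{Z}_p^2\to\{0,1\}$; its output need not belong to $\mathsf{Line}_p$. It is $(\alpha,\beta)$-differentially private if, for all $S,S'\in(\mathbb{Z}_p^2\times\{0,1\})^n$ that differ in exactly one position and every set $T$ of functions $\mathbb{Z}_p^2\to\{0,1\}$, $\Pr[A(S)\in T]\le e^{\alpha}\Pr[A(S')\in T]+\beta$. It $(\varepsilon,\delta)$-accurately (PAC) learns $\mathsf{Line}_p$ if, for every $f\in\mathsf{Line}_p$ and every probability distribution $\mathcal{D}$ on $\mathbb{Z}_p^2$, given $n$ independent points drawn from $\mathcal{D}$ and labeled by $f$, it outputs, with probability at least $1-\delta$ over the sample and its own randomness, a function $h$ with $\Pr_{z\sim\mathcal{D}}[h(z)\ne f(z)]\le\varepsilon$. **Theorem.** There is a universal constant $K>0$ such that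 for every prime $p$ and all $\varepsilon,\delta,\alpha,\beta\in(0,1/2)$ there are a number of samples $$n\le K\cdot\frac{1}{\varepsilon\alpha}\,\ln\frac1\beta\,\ln\frac1\delta$$ and a learner with $n$ samples that is $(\alpha,\beta)$-differentially private and $(\varepsilon,\delta)$-accurately learns $\mathsf{Line}_p$. -/

import Mathlib

open scoped ENNReal

/-- A labeled example: a point of the domain together with a Boolean label. -/
abbrev LabeledExample (X : Type*) : Type _ := X × Bool

/-- A randomized learning algorithm on `n` labeled examples: it maps every sample to a
probability distribution over Boolean hypotheses on `X` (not necessarily concepts of a class). -/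
abbrev Learner (X : Type*) (n : ℕ) : Type _ := (Fin n → LabeledExample X) → PMF (X → Bool)

/-- Two samples of size `n` are neighboring if they differ in exactly one position. -/
def Neighboring {X : Type*} {n : ℕ} (S S' : Fin n → LabeledExample X) : Prop :=
  ∃ i, S i ≠ S' i ∧ ∀ j, j ≠ i → S j = S' j

/-- `(α, β)`-differential privacy. -/
def IsDifferentiallyPrivate {X : Type*} {n : ℕ} (α β : ℝ) (A : Learner X n) : Prop :=
  ∀ S S' : Fin n → LabeledExample X, Neighboring S S' →
    ∀ T : Set (X → Bool),
      (A S).toOuterMeasure T ≤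
        ENNReal.ofReal (Real.exp α) * (A S').toOuterMeasure T + ENNReal.ofReal β

/-- The joint law of `n` independent draws from a distribution `D` on a finite domain. -/
noncomputable def iidSample {X : Type*} [Fintype X] (D : PMF X) (n : ℕ) : PMF (Fin n → X) :=
  PMF.ofFintype (fun x => ∏ i, D (x i)) (by
    classical
    have h : ∑ a : X, D a = 1 := by
      rw [← tsum_fintype (L := .unconditional X)]
      exact D.tsum_coe
    have h2 := Fintype.sum_pow (fun a : X => D a) n
    rw [h, one_pow] at h2
    exact h2.symm)

/-- The sample obtained by labeling every point according to the concept `f`. -/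
def labelSample {X : Type*} {n : ℕ} (f : X → Bool) (x : Fin n → X) : Fin n → LabeledExample X :=
  fun i => (x i, f (x i))

/-- The prediction error `Pr_{x ∼ D}[f x ≠ h x]`. -/
noncomputable def predictionError {X : Type*} (D : PMF X) (f h : X → Bool) : ℝ≥0∞ :=
  D.toOuterMeasure {x | f x ≠ h x}

/-- The law of the hypothesis output by `A` on `n` i.i.d. examples from `D` labeled by `f`,
over both the choice of the sample and the randomness of `A`. -/
noncomputable def outputLaw {X : Type*} [Fintype X] {n : ℕ} (A : Learner X n)
    (D : PMF X) (f : X → Bool) : PMF (X → Bool) :=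
  (iidSample D n).bind fun x => A (labelSample f x)

/-- `A` learns the concept class `C` with `(ε, δ)`-accuracy in the distribution-independent
(realizable) PAC model over a finite domain. -/
def IsPACLearner {X : Type*} [Fintype X] {n : ℕ} (ε δ : ℝ) (C : Set (X → Bool))
    (A : Learner X n) : Prop :=
  ∀ f ∈ C, ∀ D : PMF X,
    ENNReal.ofReal (1 - δ) ≤
      (outputLaw A D f).toOuterMeasure {h | predictionError D f h ≤ ENNReal.ofReal ε}

/-- The class of (indicator functions of) non-vertical lines `y = a x + b` in the affine plane
over `ℤ/pℤ`. -/
def LineClass (p : ℕ) : Set (ZMod p × ZMod p → Bool) :=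
  {f | ∃ a b : ZMod p, ∀ x y : ZMod p, f (x, y) = true ↔ a * x + b = y}

/-! Two lines share at most one point. So score a line by the number of positive examples on it that
remain when its most frequent point is disregarded: on a sample labeled by one line, every other
line scores `0`. If the best score is small, then either there are many positive examples and
almost all of them sit at a single point, whose indicator is an accurate hypothesis, or there are
few, and the indicators of all positive points and the empty hypothesis are accurate.

Either choice is made private by stable selection. Replacing one example moves every score by at
most `1`, so the lead of the best candidate over the second best one moves by at most `2`, and the
best candidate can change only if that lead is at most `2`. Releasing the best candidate with a
logistic probability in its lead, cut off so that it vanishes up to lead `2` and is `1` from lead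
`O(log (1 / β) / α)` on, therefore costs only constant multiples of `α` and `β`, independently of
the number of candidates.

For accuracy, the sample has to hit `L` and all the sets `L \ {z}` of non-negligible mass, where `L`
is the set of positive points. No union bound over `z` is needed: either `L` contains two disjoint
sets of large mass, and removing a point spares one of them, or almost all of the mass of `L` sits
at one point. -/

open scoped unitInterval

section Margin

variable {H : Type*} [Finite H] [Nonempty H]

/-- A maximizer of the score `q`, chosen arbitrarily among all of them. -/
noncomputable def winner (q : H → ℕ) : H :=
  (Finite.exists_max q).choose

theorem le_winner (q : H → ℕ) (h : H) : q h ≤ q (winner q) :=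
  (Finite.exists_max q).choose_spec h

theorem winner_eq_of_forall_lt {q : H → ℕ} {w : H} (hw : ∀ h ≠ w, q h < q w) : winner q = w := by
  by_contra hne
  exact (hw _ hne).not_ge (le_winner q w)

/-- The amount by which the best score exceeds the second best one. A lone candidate competes
against score `0`, the supremum of the empty family in `ℕ`. -/
noncomputable def margin (q : H → ℕ) : ℕ :=
  q (winner q) - ⨆ h : {h // h ≠ winner q}, q h

theorem le_margin_iff {q : H → ℕ} {k : ℕ} :
    k ≤ margin q ↔ k ≤ q (winner q) ∧ ∀ h ≠ winner q, q h + k ≤ q (winner q) := by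
  have hsup : ⨆ h : {h // h ≠ winner q}, q h ≤ q (winner q) := ciSup_le' fun h => le_winner q h
  rw [margin, Nat.le_sub_iff_add_le hsup]
  constructor
  · intro hk
    refine ⟨by omega, fun h hne => ?_⟩
    have hle : q h ≤ ⨆ h : {h // h ≠ winner q}, q h :=
      Finite.le_ciSup (fun h : {h // h ≠ winner q} => q h) ⟨h, hne⟩
    omega
  · rintro ⟨hk, hlead⟩
    have : ⨆ h : {h // h ≠ winner q}, q h ≤ q (winner q) - k :=
      ciSup_le' fun h => Nat.le_sub_of_add_le (hlead h h.2)
    omega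

theorem margin_le_winner (q : H → ℕ) : margin q ≤ q (winner q) :=
  (le_margin_iff.1 le_rfl).1

theorem add_margin_le_winner {q : H → ℕ} {h : H} (hh : h ≠ winner q) :
    q h + margin q ≤ q (winner q) :=
  (le_margin_iff.1 le_rfl).2 h hh

theorem le_margin {q : H → ℕ} {w : H} {k : ℕ} (hk : k ≤ q w) (hlead : ∀ h ≠ w, q h + k ≤ q w) :
    k ≤ margin q := by
  rcases k.eq_zero_or_pos with rfl | hpos
  · exact Nat.zero_le _
  have hw : winner q = w := winner_eq_of_forall_lt fun h hne => by have := hlead h hne; omega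
  rw [le_margin_iff, hw]
  exact ⟨hk, hlead⟩

variable {q q' : H → ℕ}

theorem margin_le_two_of_winner_ne (hqq' : ∀ h, q h ≤ q' h + 1) (hq'q : ∀ h, q' h ≤ q h + 1)
    (hw : winner q ≠ winner q') : margin q ≤ 2 := by
  have hlead := add_margin_le_winner hw.symm
  have h₁ := hqq' (winner q)
  have h₂ := hq'q (winner q')
  have h₃ := le_winner q' (winner q)
  omega

theorem margin_le_margin_add_two (hqq' : ∀ h, q h ≤ q' h + 1) (hq'q : ∀ h, q' h ≤ q h + 1) :
    margin q ≤ margin q' + 2 := by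
  by_cases hw : winner q = winner q'
  · suffices margin q - 2 ≤ margin q' by omega
    have h₁ := hqq' (winner q)
    refine le_margin_iff.2 ⟨?_, fun h hh => ?_⟩ <;> rw [← hw]
    · have := margin_le_winner q
      omega
    · rw [← hw] at hh
      have hlead := add_margin_le_winner hh
      have h₂ := hq'q h
      have h₃ := hw ▸ le_winner q' h
      omega
  · have := margin_le_two_of_winner_ne hqq' hq'q hw
    omega

end Margin

section ReleaseProbability

theorem coe_projIcc_le_mul_add {E d u u' : ℝ} (hE : 1 ≤ E) (hd : 0 ≤ d) (h : u ≤ E * u' + d) :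
    (Set.projIcc (0 : ℝ) 1 zero_le_one u : ℝ) ≤ E * Set.projIcc (0 : ℝ) 1 zero_le_one u' + d := by
  rcases le_total u' 1 with hu' | hu'
  · have hmono : E * u' ≤ E * max 0 (min 1 u') := by
      rw [min_eq_right hu']
      gcongr
      exact le_max_right _ _
    rw [Set.coe_projIcc, Set.coe_projIcc]
    refine max_le (by positivity) ((min_le_right _ _).trans ?_)
    linarith
  · rw [Set.projIcc_of_right_le _ hu']
    have := (Set.projIcc (0 : ℝ) 1 zero_le_one u).2.2
    linarith

theorem sigmoid_le_exp_mul_sigmoid {x x' s : ℝ} (hs : 0 ≤ s) (h : x ≤ x' + s) :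
    Real.sigmoid x ≤ Real.exp s * Real.sigmoid x' := by
  refine (Real.sigmoid_le h).trans ?_
  have hs1 := Real.one_le_exp hs
  have hcancel : Real.exp s * Real.exp (-(x' + s)) = Real.exp (-x') := by
    rw [← Real.exp_add]
    ring_nf
  rw [Real.sigmoid_def, Real.sigmoid_def, ← div_eq_mul_inv, inv_eq_one_div,
    div_le_div_iff₀ (by positivity) (by positivity), one_mul, mul_add,
    hcancel]
  linarith

/-- The logistic function, stretched about `1 / 2` by the factor `1 + 2 * c` and cut off at `0` and
`1`. The cutoff makes it attain these two values at finite arguments. -/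
noncomputable def clippedSigmoid (c x : ℝ) : I :=
  Set.projIcc 0 1 zero_le_one ((1 + 2 * c) * Real.sigmoid x - c)

theorem symm_clippedSigmoid (c x : ℝ) : σ (clippedSigmoid c x) = clippedSigmoid c (-x) := by
  rw [clippedSigmoid, clippedSigmoid, unitInterval.symm_projIcc, Real.sigmoid_neg]
  congr 1
  ring

theorem clippedSigmoid_le {c s x x' : ℝ} (hc : 0 ≤ c) (hs : 0 ≤ s) (h : x ≤ x' + s) :
    (clippedSigmoid c x : ℝ) ≤ Real.exp s * clippedSigmoid c x' + (Real.exp s - 1) * c := by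
  have hs1 := Real.one_le_exp hs
  refine coe_projIcc_le_mul_add hs1 (mul_nonneg (by linarith) hc) ?_
  have := mul_le_mul_of_nonneg_left (sigmoid_le_exp_mul_sigmoid hs h)
    (show 0 ≤ 1 + 2 * c by linarith)
  linarith

theorem clippedSigmoid_eq_zero {c x : ℝ} (hc : 0 < c) (hx : x ≤ -Real.log (1 + 1 / c)) :
    clippedSigmoid c x = 0 := by
  refine Set.projIcc_of_le_left _ (sub_nonpos.2 ?_)
  calc (1 + 2 * c) * Real.sigmoid x
      ≤ (1 + 2 * c) * Real.sigmoid (-Real.log (1 + 1 / c)) := by gcongr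
    _ = c := by
        rw [Real.sigmoid_def, neg_neg, Real.exp_log (by positivity)]
        field_simp
        ring

theorem clippedSigmoid_eq_one {c x : ℝ} (hc : 0 < c) (hx : Real.log (1 + 1 / c) ≤ x) :
    clippedSigmoid c x = 1 := by
  rw [← unitInterval.symm_inj, symm_clippedSigmoid, unitInterval.symm_one]
  exact clippedSigmoid_eq_zero hc (neg_le_neg hx)

/-- The probability with which a winner of margin `d` is released. The shift makes it vanish for
`d ≤ 2`, the margins at which a neighboring sample may have another winner. -/
noncomputable def releaseProb (a c : ℝ) (d : ℕ) : I :=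
  clippedSigmoid c (a * (d - 2) - Real.log (1 + 1 / c))

/-- A margin from which on the winner is released with probability one. -/
noncomputable def releaseThreshold (a c : ℝ) : ℕ :=
  ⌈2 + 2 * Real.log (1 + 1 / c) / a⌉₊

variable {a c : ℝ} {d d' : ℕ}

theorem releaseProb_eq_zero (ha : 0 ≤ a) (hc : 0 < c) (hd : d ≤ 2) : releaseProb a c d = 0 := by
  have hd' : (d : ℝ) ≤ 2 := mod_cast hd
  refine clippedSigmoid_eq_zero hc ?_
  linarith [mul_nonpos_of_nonneg_of_nonpos ha (sub_nonpos.2 hd')]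

theorem releaseProb_eq_one (ha : 0 < a) (hc : 0 < c) (hd : releaseThreshold a c ≤ d) :
    releaseProb a c d = 1 := by
  refine clippedSigmoid_eq_one hc ?_
  have hle : 2 * Real.log (1 + 1 / c) / a ≤ d - 2 := by linarith [Nat.ceil_le.1 hd]
  rw [div_le_iff₀' ha] at hle
  linarith

theorem releaseProb_le (ha : 0 ≤ a) (hc : 0 ≤ c) (h : d ≤ d' + 2) :
    (releaseProb a c d : ℝ) ≤
      Real.exp (2 * a) * releaseProb a c d' + (Real.exp (2 * a) - 1) * c := by
  have h' : (d : ℝ) ≤ d' + 2 := mod_cast h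
  exact clippedSigmoid_le hc (by positivity) (by linarith [mul_le_mul_of_nonneg_left h' ha])

theorem symm_releaseProb_le (ha : 0 ≤ a) (hc : 0 ≤ c) (h : d' ≤ d + 2) :
    (σ (releaseProb a c d) : ℝ) ≤
      Real.exp (2 * a) * σ (releaseProb a c d') + (Real.exp (2 * a) - 1) * c := by
  have h' : (d' : ℝ) ≤ d + 2 := mod_cast h
  rw [releaseProb, releaseProb, symm_clippedSigmoid, symm_clippedSigmoid]
  exact clippedSigmoid_le hc (by positivity) (by linarith [mul_le_mul_of_nonneg_left h' ha])

end ReleaseProbability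

section Indistinguishability

variable {Y : Type*}

theorem toOuterMeasure_le_one (P : PMF Y) (T : Set Y) : P.toOuterMeasure T ≤ 1 :=
  (P.toOuterMeasure.mono (Set.subset_univ T)).trans_eq
    ((P.toOuterMeasure_apply_eq_one_iff _).2 (Set.subset_univ _))

theorem toOuterMeasure_ne_top (P : PMF Y) (T : Set Y) : P.toOuterMeasure T ≠ ⊤ :=
  ne_top_of_le_ne_top ENNReal.one_ne_top (toOuterMeasure_le_one P T)

theorem toReal_toOuterMeasure_le_one (P : PMF Y) (T : Set Y) : (P.toOuterMeasure T).toReal ≤ 1 :=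
  ENNReal.toReal_mono ENNReal.one_ne_top (toOuterMeasure_le_one P T)

/-- `(α, β)`-indistinguishability, the one-sided relation between output laws that differential
privacy requires of neighboring samples. -/
def Indistinguishable (α β : ℝ) (P Q : PMF Y) : Prop :=
  ∀ T : Set Y, P.toOuterMeasure T ≤
    ENNReal.ofReal (Real.exp α) * Q.toOuterMeasure T + ENNReal.ofReal β

theorem indistinguishable_iff_toReal {α β : ℝ} (hβ : 0 ≤ β) {P Q : PMF Y} :
    Indistinguishable α β P Q ↔ ∀ T : Set Y,
      (P.toOuterMeasure T).toReal ≤ Real.exp α * (Q.toOuterMeasure T).toReal + β := by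
  refine forall_congr' fun T => ?_
  rw [← ENNReal.toReal_le_toReal (toOuterMeasure_ne_top P T)
      (by finiteness [toOuterMeasure_ne_top Q T]),
    ENNReal.toReal_add (by finiteness [toOuterMeasure_ne_top Q T]) ENNReal.ofReal_ne_top,
    ENNReal.toReal_mul, ENNReal.toReal_ofReal (Real.exp_pos α).le, ENNReal.toReal_ofReal hβ]

theorem indistinguishable_zero_refl (P : PMF Y) : Indistinguishable 0 0 P P := fun T => by simp

theorem Indistinguishable.mono {α α' β β' : ℝ} {P Q : PMF Y} (h : Indistinguishable α β P Q)
    (hα : α ≤ α') (hβ : β ≤ β') : Indistinguishable α' β' P Q := fun T =>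
  (h T).trans (by gcongr)

/-- The mixture `t * P + (1 - t) * Q` of two probability distributions. -/
noncomputable def mix (t : I) (P Q : PMF Y) : PMF Y :=
  (PMF.ofFintype (fun b => ENNReal.ofReal (bif b then t else σ t : I)) (by
    rw [Fintype.sum_bool, ← ENNReal.ofReal_add (unitInterval.nonneg _) (unitInterval.nonneg _)]
    simp)).bind fun b => bif b then P else Q

theorem toReal_toOuterMeasure_mix (t : I) (P Q : PMF Y) (T : Set Y) :
    ((mix t P Q).toOuterMeasure T).toReal =
      t * (P.toOuterMeasure T).toReal + σ t * (Q.toOuterMeasure T).toReal := by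
  simp only [mix, PMF.toOuterMeasure_bind_apply, tsum_fintype, Fintype.sum_bool,
    PMF.ofFintype_apply, cond_true, cond_false]
  rw [ENNReal.toReal_add (ENNReal.mul_ne_top ENNReal.ofReal_ne_top (toOuterMeasure_ne_top P T))
      (ENNReal.mul_ne_top ENNReal.ofReal_ne_top (toOuterMeasure_ne_top Q T)),
    ENNReal.toReal_mul, ENNReal.toReal_mul, ENNReal.toReal_ofReal (unitInterval.nonneg _),
    ENNReal.toReal_ofReal (unitInterval.nonneg _)]

theorem mem_support_mix {t : I} {P Q : PMF Y} {y : Y} (hy : y ∈ (mix t P Q).support) :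
    (t ≠ 0 ∧ y ∈ P.support) ∨ (t ≠ 1 ∧ y ∈ Q.support) := by
  obtain ⟨b, hb, hy⟩ := (PMF.mem_support_bind_iff _ _ _).1 hy
  rw [PMF.mem_support_ofFintype_iff] at hb
  cases b
  · exact Or.inr ⟨by rintro rfl; simp at hb, hy⟩
  · exact Or.inl ⟨by rintro rfl; simp at hb, hy⟩

theorem mul_le_mul_mul_add_of_le {A β κ E t t' q q' : ℝ} (hA : 0 ≤ A) (hβ : 0 ≤ β) (hκ : 0 ≤ κ)
    (ht0 : 0 ≤ t) (ht1 : t ≤ 1) (ht : t ≤ E * t' + κ) (hq0 : 0 ≤ q') (hq1 : q' ≤ 1)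
    (hq : q ≤ A * q' + β) : t * q ≤ A * E * (t' * q') + κ * A + β :=
  calc t * q ≤ t * (A * q' + β) := by gcongr
    _ = t * (A * q') + t * β := by ring
    _ ≤ (E * t' + κ) * (A * q') + 1 * β := by gcongr
    _ = A * E * (t' * q') + κ * A * q' + β := by ring
    _ ≤ A * E * (t' * q') + κ * A * 1 + β := by gcongr
    _ = A * E * (t' * q') + κ * A + β := by rw [mul_one]

theorem Indistinguishable.mix {α β s κ : ℝ} (hα : 0 ≤ α) (hβ : 0 ≤ β) (hκ : 0 ≤ κ) {t t' : I}
    {P P' Q Q' : PMF Y} (hP : P = P' ∨ t = 0) (ht : (t : ℝ) ≤ Real.exp s * t' + κ)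
    (ht' : (σ t : ℝ) ≤ Real.exp s * σ t' + κ) (hQ : Indistinguishable α β Q Q') :
    Indistinguishable (α + s) (β + κ * (1 + Real.exp α)) (mix t P Q) (mix t' P' Q') := by
  rw [indistinguishable_iff_toReal hβ] at hQ
  rw [indistinguishable_iff_toReal (by positivity)]
  intro T
  specialize hQ T
  rw [toReal_toOuterMeasure_mix, toReal_toOuterMeasure_mix, Real.exp_add]
  have hP_part : t * (P.toOuterMeasure T).toReal ≤
      Real.exp α * Real.exp s * (t' * (P'.toOuterMeasure T).toReal) + κ := by
    rcases hP with rfl | rfl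
    · have ht0 := unitInterval.nonneg t'
      calc t * (P.toOuterMeasure T).toReal
          ≤ 1 * Real.exp s * (t' * (P.toOuterMeasure T).toReal) + κ * 1 + 0 :=
            mul_le_mul_mul_add_of_le zero_le_one le_rfl hκ (unitInterval.nonneg t)
              (unitInterval.le_one t) ht ENNReal.toReal_nonneg (toReal_toOuterMeasure_le_one P T)
              (by simp)
        _ ≤ Real.exp α * Real.exp s * (t' * (P.toOuterMeasure T).toReal) + κ * 1 + 0 := by
            gcongr
            exact Real.one_le_exp hα
        _ = _ := by ring
    · rw [Set.Icc.coe_zero, zero_mul]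
      have := unitInterval.nonneg t'
      positivity
  have hQ_part : σ t * (Q.toOuterMeasure T).toReal ≤
      Real.exp α * Real.exp s * (σ t' * (Q'.toOuterMeasure T).toReal) + κ * Real.exp α + β :=
    mul_le_mul_mul_add_of_le (Real.exp_pos α).le hβ hκ (unitInterval.nonneg _)
      (unitInterval.le_one _) ht' ENNReal.toReal_nonneg (toReal_toOuterMeasure_le_one Q' T) hQ
  linarith

end Indistinguishability

section ReleaseWinner

variable {H : Type*} [Finite H] [Nonempty H] {a c : ℝ} {q q' : H → ℕ} {B B' : PMF H}

/-- The stable selection mechanism: release the winner of the score `q` with a probability that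
grows with its margin, and draw from the fallback distribution `B` otherwise. -/
noncomputable def releaseWinner (a c : ℝ) (q : H → ℕ) (B : PMF H) : PMF H :=
  mix (releaseProb a c (margin q)) (PMF.pure (winner q)) B

theorem Indistinguishable.releaseWinner {α β : ℝ} (hα : 0 ≤ α) (hβ : 0 ≤ β) (ha : 0 ≤ a)
    (hc : 0 < c) (hqq' : ∀ h, q h ≤ q' h + 1) (hq'q : ∀ h, q' h ≤ q h + 1)
    (hB : Indistinguishable α β B B') :
    Indistinguishable (α + 2 * a) (β + (Real.exp (2 * a) - 1) * c * (1 + Real.exp α))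
      (releaseWinner a c q B) (releaseWinner a c q' B') := by
  have hκ : 0 ≤ (Real.exp (2 * a) - 1) * c :=
    mul_nonneg (sub_nonneg.2 (Real.one_le_exp (by positivity))) hc.le
  refine Indistinguishable.mix hα hβ hκ ?_
    (releaseProb_le ha hc.le (margin_le_margin_add_two hqq' hq'q))
    (symm_releaseProb_le ha hc.le (margin_le_margin_add_two hq'q hqq')) hB
  by_cases hw : winner q = winner q'
  · exact Or.inl (congrArg PMF.pure hw)
  · exact Or.inr (releaseProb_eq_zero ha hc (margin_le_two_of_winner_ne hqq' hq'q hw))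

theorem mem_support_releaseWinner (ha : 0 < a) (hc : 0 < c) {h : H}
    (hh : h ∈ (releaseWinner a c q B).support) :
    (h = winner q ∧ 0 < margin q) ∨ (h ∈ B.support ∧ margin q < releaseThreshold a c) := by
  rcases mem_support_mix hh with ⟨hne, hpure⟩ | ⟨hne, hB⟩
  · refine Or.inl ⟨by simpa using hpure, Nat.pos_of_ne_zero fun h0 => hne ?_⟩
    exact releaseProb_eq_zero ha.le hc (by omega)
  · refine Or.inr ⟨hB, ?_⟩
    by_contra! hle
    exact hne (releaseProb_eq_one ha hc hle)

end ReleaseWinner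

section Learner

variable {X : Type*}

/-- The points at which a Boolean function takes the value `true`. -/
def positives (f : X → Bool) : Set X := {x | f x = true}

/-- Linearity of a concept class in the sense of linear hypergraphs: two distinct concepts have at
most one positive point in common. -/
def IsLinearClass (C : Set (X → Bool)) : Prop :=
  C.Pairwise fun f g => (positives f ∩ positives g).Subsingleton

open Classical in
/-- The concept whose only positive point is `z`. -/
noncomputable def pointIndicator (z : X) : X → Bool := fun x => decide (x = z)

theorem positives_pointIndicator (z : X) : positives (pointIndicator z) = {z} := by
  ext x
  simp [positives, pointIndicator]

theorem pointIndicator_injective : Function.Injective (pointIndicator : X → X → Bool) := by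
  intro z w h
  simpa only [positives_pointIndicator, Set.singleton_eq_singleton_iff]
    using congrArg positives h

variable {n : ℕ} {S S' : Fin n → LabeledExample X}

/-- The number of examples of the sample `S` that are labeled `true` and whose point lies in `B`. -/
noncomputable def positiveCount (S : Fin n → LabeledExample X) (B : Set X) : ℕ :=
  {i | (S i).2 = true ∧ (S i).1 ∈ B}.ncard

theorem positiveCount_labelSample (f : X → Bool) (x : Fin n → X) (B : Set X) :
    positiveCount (labelSample f x) B = (x ⁻¹' (positives f ∩ B)).ncard :=
  rfl

theorem Neighboring.symm (h : Neighboring S S') : Neighboring S' S := by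
  obtain ⟨i, hi, hj⟩ := h
  exact ⟨i, hi.symm, fun j hne => (hj j hne).symm⟩

theorem Neighboring.positiveCount_le (h : Neighboring S S') (B : Set X) :
    positiveCount S B ≤ positiveCount S' B + 1 := by
  obtain ⟨i, -, hj⟩ := h
  refine (Set.ncard_le_ncard (t := insert i {j | (S' j).2 = true ∧ (S' j).1 ∈ B}) ?_).trans
    (Set.ncard_insert_le _ _)
  intro j hmem
  rcases eq_or_ne j i with rfl | hne
  · exact Set.mem_insert _ _
  · exact Set.mem_insert_of_mem _ (by simpa only [Set.mem_ofPred_eq, hj j hne] using hmem)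

/-- The score of the hypothesis `g` in the first stage: the number of positive examples on `g`
that remain when the most frequent point of `g` is disregarded. Hypotheses outside `C` score `0`. -/
noncomputable def coreScore (C : Set (X → Bool)) (S : Fin n → LabeledExample X) : (X → Bool) → ℕ :=
  C.indicator fun g => ⨅ z, positiveCount S (positives g \ {z})

/-- The score of the hypothesis `g` in the second stage: the number of positive examples at `z` if
`g` is the indicator of the point `z`, and `0` otherwise. -/
noncomputable def pointScore (S : Fin n → LabeledExample X) (g : X → Bool) : ℕ :=
  positiveCount S {z | pointIndicator z = g}

theorem Neighboring.coreScore_le (h : Neighboring S S') (C : Set (X → Bool)) (g : X → Bool) :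
    coreScore C S g ≤ coreScore C S' g + 1 := by
  by_cases hg : g ∈ C
  · have : Nonempty X := h.elim fun i _ => ⟨(S i).1⟩
    rw [coreScore, coreScore, Set.indicator_of_mem hg, Set.indicator_of_mem hg]
    obtain ⟨z, hz⟩ := ciInf_mem fun z => positiveCount S' (positives g \ {z})
    rw [← hz]
    exact (ciInf_le (OrderBot.bddBelow _) z).trans (h.positiveCount_le _)
  · simp only [coreScore, Set.indicator_of_notMem hg, zero_le]

theorem Neighboring.pointScore_le (h : Neighboring S S') (g : X → Bool) :
    pointScore S g ≤ pointScore S' g + 1 :=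
  h.positiveCount_le _

/-- Release the concept with the best core score if its lead is large enough, otherwise the
indicator of the most frequent positive point if its lead is large enough, and otherwise the
hypothesis that is `false` everywhere. -/
noncomputable def linearClassLearner [Finite X] (C : Set (X → Bool)) (n : ℕ) (a c : ℝ) :
    Learner X n := fun S =>
  releaseWinner a c (coreScore C S)
    (releaseWinner a c (pointScore S) (PMF.pure fun _ => false))

theorem linearClassLearner_isDifferentiallyPrivate [Finite X] (C : Set (X → Bool)) (n : ℕ)
    {a c : ℝ} (ha : 0 ≤ a) (ha2 : Real.exp (2 * a) ≤ 2) (hc : 0 < c) :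
    IsDifferentiallyPrivate (4 * a) (5 * c) (linearClassLearner C n a c) := by
  intro S S' h
  have hpoint := (indistinguishable_zero_refl (PMF.pure fun _ : X => false)).releaseWinner
    le_rfl le_rfl ha hc h.pointScore_le h.symm.pointScore_le
  have hκ : (Real.exp (2 * a) - 1) * c ≤ c :=
    (mul_le_mul_of_nonneg_right (by linarith) hc.le).trans_eq (one_mul c)
  have hκ₀ : 0 ≤ (Real.exp (2 * a) - 1) * c :=
    mul_nonneg (sub_nonneg.2 (Real.one_le_exp (by positivity))) hc.le
  rw [zero_add, zero_add, Real.exp_zero] at hpoint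
  refine (hpoint.releaseWinner (by positivity) (by positivity) ha hc (h.coreScore_le C)
    (h.symm.coreScore_le C)).mono (by linarith) ?_
  calc (Real.exp (2 * a) - 1) * c * (1 + 1) +
        (Real.exp (2 * a) - 1) * c * (1 + Real.exp (2 * a))
      ≤ c * (1 + 1) + c * (1 + 2) := by gcongr
    _ = 5 * c := by ring

end Learner

section Accuracy

variable {X : Type*} {n : ℕ} {C : Set (X → Bool)} {f g : X → Bool} {x : Fin n → X} {z : X}

theorem coreScore_labelSample_of_ne [Nonempty X] (hC : IsLinearClass C) (hf : f ∈ C) (hg : g ≠ f) :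
    coreScore C (labelSample f x) g = 0 := by
  by_cases hgC : g ∈ C
  · obtain ⟨z, hz⟩ : ∃ z, positives f ∩ positives g ⊆ {z} := by
      rcases (hC hf hgC hg.symm).eq_empty_or_singleton with h | ⟨z, h⟩
      · exact ⟨Classical.arbitrary X, h ▸ Set.empty_subset _⟩
      · exact ⟨z, h.subset⟩
    rw [coreScore, Set.indicator_of_mem hgC, ← Nat.le_zero]
    refine (ciInf_le (OrderBot.bddBelow _) z).trans_eq ?_
    rw [positiveCount_labelSample, ← Set.inter_sdiff_assoc, Set.sdiff_eq_empty.2 hz,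
      Set.preimage_empty, Set.ncard_empty]
  · exact Set.indicator_of_notMem hgC _

theorem exists_coreScore_labelSample_self_eq [Nonempty X] (hf : f ∈ C) (x : Fin n → X) :
    ∃ z, coreScore C (labelSample f x) f = (x ⁻¹' (positives f \ {z})).ncard := by
  obtain ⟨z, hz⟩ := ciInf_mem fun z => positiveCount (labelSample f x) (positives f \ {z})
  refine ⟨z, ?_⟩
  rw [coreScore, Set.indicator_of_mem hf, ← hz]
  simp only [positiveCount_labelSample, ← Set.inter_sdiff_assoc, Set.inter_self]

theorem pointScore_labelSample_pointIndicator (f : X → Bool) (x : Fin n → X) (z : X) :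
    pointScore (labelSample f x) (pointIndicator z) = (x ⁻¹' (positives f ∩ {z})).ncard := by
  simp only [pointScore, pointIndicator_injective.eq_iff, Set.ofPred_eq_eq_singleton,
    positiveCount_labelSample]

theorem pointScore_labelSample_le (hg : g ≠ pointIndicator z) :
    pointScore (labelSample f x) g ≤ (x ⁻¹' (positives f \ {z})).ncard := by
  rw [pointScore, positiveCount_labelSample]
  refine Set.ncard_le_ncard (Set.preimage_mono fun w hw => ⟨hw.1, ?_⟩)
  rintro rfl
  exact hg hw.2.symm

theorem exists_eq_pointIndicator_of_pos (h : 0 < pointScore (labelSample f x) g) :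
    ∃ z ∈ positives f, g = pointIndicator z := by
  obtain ⟨i, hi⟩ : {i | (labelSample f x i).2 = true ∧ pointIndicator (x i) = g}.Nonempty :=
    Set.nonempty_of_ncard_ne_zero h.ne'
  exact ⟨x i, hi.1, hi.2.symm⟩

theorem predictionError_pointIndicator_le (D : PMF X) (hz : z ∈ positives f) :
    predictionError D f (pointIndicator z) ≤ D.toOuterMeasure (positives f \ {z}) := by
  refine D.toOuterMeasure.mono fun w hw => ?_
  have hwz : w ≠ z := by
    rintro rfl
    exact hw (hz.trans (by simp [pointIndicator]))
  simpa [pointIndicator, positives, hwz] using hw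

theorem predictionError_false (D : PMF X) (f : X → Bool) :
    predictionError D f (fun _ => false) = D.toOuterMeasure (positives f) := by
  simp only [predictionError, positives, ne_eq, Bool.not_eq_false]

/-- The sample `x` is representative of the set `L` if `L`, and also `L` with any one point removed,
either has `D`-mass at most `e` or is hit at least `m` times. Both are covered by letting `Z` range
over the sets with at most one element. -/
def IsRepresentative (D : PMF X) (L : Set X) (e : ℝ≥0∞) (m : ℕ) (x : Fin n → X) : Prop :=
  ∀ Z : Set X, Z.Subsingleton →
    D.toOuterMeasure (L \ Z) ≤ e ∨ m ≤ (x ⁻¹' (L \ Z)).ncard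

variable [Finite X]

theorem winner_coreScore_eq [Nonempty X] (hC : IsLinearClass C) (hf : f ∈ C)
    (h : 0 < margin (coreScore C (labelSample f x))) :
    winner (coreScore C (labelSample f x)) = f := by
  by_contra hne
  have := coreScore_labelSample_of_ne (x := x) hC hf hne
  have := margin_le_winner (coreScore C (labelSample f x))
  omega

theorem exists_ncard_lt_of_margin_coreScore_lt [Nonempty X] (hC : IsLinearClass C) (hf : f ∈ C)
    {T : ℕ} (h : margin (coreScore C (labelSample f x)) < T) :
    ∃ z, (x ⁻¹' (positives f \ {z})).ncard < T := by
  obtain ⟨z, hz⟩ := exists_coreScore_labelSample_self_eq hf x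
  refine ⟨z, ?_⟩
  by_contra! hT
  rw [← hz] at hT
  refine h.not_ge (le_margin hT fun g hg => ?_)
  rwa [coreScore_labelSample_of_ne hC hf hg, zero_add]

theorem le_margin_pointScore {T : ℕ}
    (h : (x ⁻¹' (positives f \ {z})).ncard + T ≤ (x ⁻¹' (positives f ∩ {z})).ncard) :
    T ≤ margin (pointScore (labelSample f x)) := by
  have hz := pointScore_labelSample_pointIndicator f x z
  refine le_margin (w := pointIndicator z) (by omega) fun g hg => ?_
  have := pointScore_labelSample_le (f := f) (x := x) hg
  omega

theorem winner_pointScore_eq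
    (h : (x ⁻¹' (positives f \ {z})).ncard < (x ⁻¹' (positives f ∩ {z})).ncard) :
    winner (pointScore (labelSample f x)) = pointIndicator z := by
  refine winner_eq_of_forall_lt fun g hg => ?_
  rw [pointScore_labelSample_pointIndicator]
  exact (pointScore_labelSample_le hg).trans_lt h

variable {D : PMF X} {e : ℝ≥0∞} {a c : ℝ} {h : X → Bool}

theorem predictionError_le_of_mem_support_fallback (ha : 0 < a) (hc : 0 < c)
    (hx : IsRepresentative D (positives f) e (3 * releaseThreshold a c) x)
    (hz : (x ⁻¹' (positives f \ {z})).ncard < releaseThreshold a c)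
    (hh : h ∈ (releaseWinner a c (pointScore (labelSample f x))
      (PMF.pure fun _ => false)).support) :
    predictionError D f h ≤ e := by
  have hDz : D.toOuterMeasure (positives f \ {z}) ≤ e :=
    (hx {z} Set.subsingleton_singleton).resolve_right (by omega)
  by_cases hD : D.toOuterMeasure (positives f) ≤ e
  · rcases mem_support_releaseWinner ha hc hh with ⟨rfl, hpos⟩ | ⟨hfalse, -⟩
    · obtain ⟨w, hw, hw_eq⟩ := exists_eq_pointIndicator_of_pos (hpos.trans_le (margin_le_winner _))
      rw [hw_eq]
      exact (predictionError_pointIndicator_le D hw).trans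
        ((D.toOuterMeasure.mono Set.sdiff_subset).trans hD)
    · rw [(PMF.mem_support_pure_iff _ _).1 hfalse, predictionError_false]
      exact hD
  · have hcount : 3 * releaseThreshold a c ≤ (x ⁻¹' positives f).ncard := by
      simpa only [Set.sdiff_empty, hD, false_or] using hx ∅ Set.subsingleton_empty
    have hsplit := Set.ncard_inter_add_ncard_sdiff_eq_ncard (x ⁻¹' positives f) (x ⁻¹' {z})
    rw [← Set.preimage_inter, ← Set.preimage_sdiff] at hsplit
    have hwinner : winner (pointScore (labelSample f x)) = pointIndicator z :=
      winner_pointScore_eq (by omega)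
    have hmargin : releaseThreshold a c ≤ margin (pointScore (labelSample f x)) :=
      le_margin_pointScore (z := z) (by omega)
    rcases mem_support_releaseWinner ha hc hh with ⟨rfl, hpos⟩ | ⟨-, hlt⟩
    · obtain ⟨w, hw, hw_eq⟩ := exists_eq_pointIndicator_of_pos (hpos.trans_le (margin_le_winner _))
      obtain rfl : w = z := pointIndicator_injective (hw_eq.symm.trans hwinner)
      rw [hw_eq]
      exact (predictionError_pointIndicator_le D hw).trans hDz
    · omega

theorem predictionError_le_of_mem_support (hC : IsLinearClass C) (hf : f ∈ C) (ha : 0 < a)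
    (hc : 0 < c) (hx : IsRepresentative D (positives f) e (3 * releaseThreshold a c) x)
    (hh : h ∈ (linearClassLearner C n a c (labelSample f x)).support) :
    predictionError D f h ≤ e := by
  have : Nonempty X := D.support_nonempty.to_type
  rcases mem_support_releaseWinner ha hc hh with ⟨rfl, hpos⟩ | ⟨hh, hlt⟩
  · rw [winner_coreScore_eq hC hf hpos]
    simp [predictionError]
  · obtain ⟨z, hz⟩ := exists_ncard_lt_of_margin_coreScore_lt hC hf hlt
    exact predictionError_le_of_mem_support_fallback ha hc hx hz hh

end Accuracy

section Sampling

variable {X : Type*}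

theorem exists_disjoint_or_singleton [Finite X] (D : PMF X) {L : Set X} {e : ℝ≥0∞} (he0 : e ≠ 0)
    (hL : 3 * e < D.toOuterMeasure L) :
    (∃ A ⊆ L, ∃ B ⊆ L, Disjoint A B ∧ e ≤ D.toOuterMeasure A ∧ e ≤ D.toOuterMeasure B) ∨
      ∃ z ∈ L, e ≤ D.toOuterMeasure {z} ∧ D.toOuterMeasure (L \ {z}) ≤ 2 * e := by
  have heL : e ≤ D.toOuterMeasure L := le_trans (le_mul_of_one_le_left' (by norm_num)) hL.le
  obtain ⟨A, hA⟩ := Set.Finite.exists_minimal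
    (Set.toFinite {A : Set X | A ⊆ L ∧ e ≤ D.toOuterMeasure A}) ⟨L, subset_rfl, heL⟩
  obtain ⟨hAL, hAe⟩ := hA.prop
  by_cases hB : e ≤ D.toOuterMeasure (L \ A)
  · exact Or.inl ⟨A, hAL, L \ A, Set.sdiff_subset, Set.disjoint_sdiff_right, hAe, hB⟩
  obtain ⟨z, hz⟩ : A.Nonempty := by
    rw [Set.nonempty_iff_ne_empty]
    rintro rfl
    exact he0 (by simpa using hAe)
  have hAz : D.toOuterMeasure (A \ {z}) ≤ e := by
    by_contra! h
    exact (hA.le_of_le ⟨Set.sdiff_subset.trans hAL, h.le⟩ Set.sdiff_subset hz).2 rfl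
  have hLz : D.toOuterMeasure (L \ {z}) ≤ 2 * e :=
    calc D.toOuterMeasure (L \ {z})
        ≤ D.toOuterMeasure (A \ {z} ∪ L \ A) := D.toOuterMeasure.mono fun x hx => by
          by_cases hxA : x ∈ A
          · exact Or.inl ⟨hxA, hx.2⟩
          · exact Or.inr ⟨hx.1, hxA⟩
      _ ≤ e + e := (MeasureTheory.measure_union_le _ _).trans (add_le_add hAz (not_le.1 hB).le)
      _ = 2 * e := (two_mul e).symm
  refine Or.inr ⟨z, hAL hz, ?_, hLz⟩
  by_contra! hlt
  refine hL.not_ge ?_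
  calc D.toOuterMeasure L
      ≤ D.toOuterMeasure ({z} ∪ L \ {z}) := D.toOuterMeasure.mono (by simp)
    _ ≤ e + 2 * e := (MeasureTheory.measure_union_le _ _).trans (add_le_add hlt.le hLz)
    _ = 3 * e := by ring

theorem exists_subset_sdiff_of_subsingleton [Finite X] (D : PMF X) (L : Set X) {e : ℝ≥0∞}
    (he0 : e ≠ 0) (he1 : e ≤ 1) :
    ∃ A B : Set X, e ≤ D.toOuterMeasure A ∧ e ≤ D.toOuterMeasure B ∧
      ∀ Z : Set X, Z.Subsingleton → D.toOuterMeasure (L \ Z) ≤ 3 * e ∨ A ⊆ L \ Z ∨ B ⊆ L \ Z := by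
  rcases le_or_gt (D.toOuterMeasure L) (3 * e) with hL | hL
  · have huniv : D.toOuterMeasure Set.univ = 1 :=
      (D.toOuterMeasure_apply_eq_one_iff _).2 (Set.subset_univ _)
    exact ⟨Set.univ, Set.univ, huniv ▸ he1, huniv ▸ he1, fun Z _ =>
      Or.inl ((D.toOuterMeasure.mono Set.sdiff_subset).trans hL)⟩
  rcases exists_disjoint_or_singleton D he0 hL with
    ⟨A, hA, B, hB, hAB, hAe, hBe⟩ | ⟨z, hz, hze, hLz⟩
  · refine ⟨A, B, hAe, hBe, fun Z hZ => Or.inr ?_⟩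
    simp only [Set.subset_sdiff, hA, hB, true_and]
    by_contra! h
    obtain ⟨v, hvA, hvZ⟩ := Set.not_disjoint_iff.1 h.1
    obtain ⟨w, hwB, hwZ⟩ := Set.not_disjoint_iff.1 h.2
    exact Set.disjoint_left.1 hAB hvA (hZ hvZ hwZ ▸ hwB)
  · refine ⟨{z}, {z}, hze, hze, fun Z _ => ?_⟩
    by_cases hzZ : z ∈ Z
    · refine Or.inl ((D.toOuterMeasure.mono ?_).trans (hLz.trans ?_))
      · exact Set.sdiff_subset_sdiff_right (Set.singleton_subset_iff.2 hzZ)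
      · gcongr
        norm_num
    · exact Or.inr (Or.inl (Set.singleton_subset_iff.2 ⟨hz, hzZ⟩))

open Classical in
theorem one_le_two_pow_mul_prod {n m : ℕ} {A : Set X} {x : Fin n → X} (hx : (x ⁻¹' A).ncard ≤ m) :
    1 ≤ 2 ^ m * ∏ i, (if x i ∈ A then (2⁻¹ : ℝ≥0∞) else 1) := by
  have hcard : (x ⁻¹' A).ncard = (Finset.univ.filter fun i => x i ∈ A).card := by
    rw [← Set.ncard_coe_finset]
    congr 1
    ext i
    simp
  rw [Finset.prod_ite, Finset.prod_const_one, mul_one, Finset.prod_const, ← hcard]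
  obtain ⟨k, rfl⟩ := Nat.exists_eq_add_of_le hx
  rw [pow_add, mul_right_comm, ← mul_pow, ENNReal.mul_inv_cancel (by norm_num) (by norm_num),
    one_pow, one_mul]
  exact one_le_pow₀ (by norm_num)

variable [Fintype X]

open Classical in
theorem sum_mul_ite_half_le_exp (D : PMF X) {A : Set X} {r : ℝ} (hr : 0 ≤ r)
    (hA : ENNReal.ofReal r ≤ D.toOuterMeasure A) :
    ∑ a, D a * (if a ∈ A then 2⁻¹ else 1) ≤ ENNReal.ofReal (Real.exp (-(r / 2))) := by
  have hsum : ∑ a, D a = 1 := (tsum_fintype _).symm.trans D.tsum_coe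
  have hcompl : ∑ a, D a * (if a ∈ A then (2⁻¹ : ℝ≥0∞) else 1) + D.toOuterMeasure A * 2⁻¹ = 1 := by
    rw [PMF.toOuterMeasure_apply_fintype, Finset.sum_mul, ← Finset.sum_add_distrib]
    refine (Finset.sum_congr rfl fun a _ => ?_).trans hsum
    by_cases ha : a ∈ A
    · rw [Set.indicator_of_mem ha, if_pos ha, ← mul_add, ENNReal.inv_two_add_inv_two, mul_one]
    · rw [Set.indicator_of_notMem ha, if_neg ha, mul_one, zero_mul, add_zero]
  have hhalf : ENNReal.ofReal (r / 2) ≤ D.toOuterMeasure A * 2⁻¹ := by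
    rw [div_eq_mul_inv, ENNReal.ofReal_mul hr, ENNReal.ofReal_inv_of_pos (by norm_num),
      ENNReal.ofReal_ofNat]
    gcongr
  calc ∑ a, D a * (if a ∈ A then (2⁻¹ : ℝ≥0∞) else 1)
      ≤ 1 - ENNReal.ofReal (r / 2) :=
        ENNReal.le_sub_of_add_le_right ENNReal.ofReal_ne_top
          ((add_le_add_right hhalf _).trans_eq hcompl)
    _ = ENNReal.ofReal (1 - r / 2) := by
        rw [ENNReal.ofReal_sub _ (by positivity), ENNReal.ofReal_one]
    _ ≤ ENNReal.ofReal (Real.exp (-(r / 2))) :=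
        ENNReal.ofReal_le_ofReal (by linarith [Real.add_one_le_exp (-(r / 2))])

-- The Markov inequality applied to `2 ^ (m - k)`, where `k` is the number of hits of `A`.
theorem iidSample_ncard_preimage_lt_le (D : PMF X) (n m : ℕ) {A : Set X} {r : ℝ} (hr : 0 ≤ r)
    (hA : ENNReal.ofReal r ≤ D.toOuterMeasure A) :
    (iidSample D n).toOuterMeasure {x | (x ⁻¹' A).ncard < m} ≤
      ENNReal.ofReal (2 ^ m * Real.exp (-(n * r / 2))) := by
  classical
  calc (iidSample D n).toOuterMeasure {x | (x ⁻¹' A).ncard < m}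
      ≤ ∑ x : Fin n → X, 2 ^ m * ∏ i, (D (x i) * (if x i ∈ A then (2⁻¹ : ℝ≥0∞) else 1)) := by
        rw [PMF.toOuterMeasure_apply_fintype]
        refine Finset.sum_le_sum fun x _ => Set.indicator_apply_le' (fun hx => ?_) fun _ => zero_le
        rw [iidSample, PMF.ofFintype_apply, Finset.prod_mul_distrib, mul_left_comm]
        exact le_mul_of_one_le_right' (one_le_two_pow_mul_prod hx.le)
    _ = 2 ^ m * (∑ a, D a * (if a ∈ A then (2⁻¹ : ℝ≥0∞) else 1)) ^ n := by
        rw [← Finset.mul_sum, Fintype.sum_pow]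
    _ ≤ 2 ^ m * ENNReal.ofReal (Real.exp (-(r / 2))) ^ n := by
        gcongr
        exact sum_mul_ite_half_le_exp D hr hA
    _ = ENNReal.ofReal (2 ^ m * Real.exp (-(n * r / 2))) := by
        rw [ENNReal.ofReal_mul (by positivity), ENNReal.ofReal_pow (by norm_num),
          ENNReal.ofReal_ofNat, ← ENNReal.ofReal_pow (by positivity), ← Real.exp_nat_mul]
        ring_nf

theorem iidSample_not_isRepresentative_le (D : PMF X) (L : Set X) (n m : ℕ) {e : ℝ} (he0 : 0 < e)
    (he1 : e ≤ 1) :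
    (iidSample D n).toOuterMeasure {x | ¬IsRepresentative D L (3 * ENNReal.ofReal e) m x} ≤
      ENNReal.ofReal (2 * (2 ^ m * Real.exp (-(n * e / 2)))) := by
  obtain ⟨A, B, hA, hB, hAB⟩ := exists_subset_sdiff_of_subsingleton D L
    (ENNReal.ofReal_pos.2 he0).ne' (ENNReal.ofReal_le_one.2 he1)
  calc (iidSample D n).toOuterMeasure {x | ¬IsRepresentative D L (3 * ENNReal.ofReal e) m x}
      ≤ (iidSample D n).toOuterMeasure
          ({x | (x ⁻¹' A).ncard < m} ∪ {x | (x ⁻¹' B).ncard < m}) := by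
        refine (iidSample D n).toOuterMeasure.mono fun x hx => ?_
        by_contra! hAm
        simp only [Set.mem_union, Set.mem_ofPred_eq, not_or, not_lt] at hAm
        refine hx fun Z hZ => (hAB Z hZ).imp_right ?_
        rintro (h | h)
        · exact hAm.1.trans (Set.ncard_le_ncard (Set.preimage_mono h))
        · exact hAm.2.trans (Set.ncard_le_ncard (Set.preimage_mono h))
    _ ≤ ENNReal.ofReal (2 ^ m * Real.exp (-(n * e / 2))) +
          ENNReal.ofReal (2 ^ m * Real.exp (-(n * e / 2))) :=
        (MeasureTheory.measure_union_le _ _).trans (add_le_add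
          (iidSample_ncard_preimage_lt_le D n m he0.le hA)
          (iidSample_ncard_preimage_lt_le D n m he0.le hB))
    _ = ENNReal.ofReal (2 * (2 ^ m * Real.exp (-(n * e / 2)))) := by
        rw [← ENNReal.ofReal_add (by positivity) (by positivity), two_mul]

theorem ofReal_one_sub_le_toOuterMeasure_bind {Y Z : Type*} {P : PMF Y} {k : Y → PMF Z} {G : Set Y}
    {U : Set Z} {δ : ℝ} (hδ : 0 ≤ δ) (hG : P.toOuterMeasure Gᶜ ≤ ENNReal.ofReal δ)
    (hU : ∀ y ∈ G, (k y).support ⊆ U) :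
    ENNReal.ofReal (1 - δ) ≤ (P.bind k).toOuterMeasure U := by
  have huniv : 1 ≤ P.toOuterMeasure G + P.toOuterMeasure Gᶜ := by
    rw [← (P.toOuterMeasure_apply_eq_one_iff Set.univ).2 (Set.subset_univ _),
      ← Set.union_compl_self G]
    exact MeasureTheory.measure_union_le _ _
  calc ENNReal.ofReal (1 - δ)
      = 1 - ENNReal.ofReal δ := by rw [ENNReal.ofReal_sub _ hδ, ENNReal.ofReal_one]
    _ ≤ P.toOuterMeasure G := tsub_le_iff_right.2 (huniv.trans (by gcongr))
    _ ≤ (P.bind k).toOuterMeasure U := by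
        rw [PMF.toOuterMeasure_bind_apply, PMF.toOuterMeasure_apply]
        refine ENNReal.tsum_le_tsum fun y => Set.indicator_apply_le' (fun hy => ?_) fun _ => zero_le
        rw [((k y).toOuterMeasure_apply_eq_one_iff U).2 (hU y hy), mul_one]

theorem linearClassLearner_isPACLearner {C : Set (X → Bool)} (hC : IsLinearClass C) {n : ℕ}
    {a c ε δ : ℝ} (ha : 0 < a) (hc : 0 < c) (hε0 : 0 < ε) (hε1 : ε ≤ 1)
    (hn : 2 * (2 ^ (3 * releaseThreshold a c) * Real.exp (-(n * (ε / 3) / 2))) ≤ δ) :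
    IsPACLearner ε δ C (linearClassLearner C n a c) := by
  intro f hf D
  have hε : 3 * ENNReal.ofReal (ε / 3) = ENNReal.ofReal ε := by
    rw [← ENNReal.ofReal_ofNat 3, ← ENNReal.ofReal_mul (by norm_num),
      mul_div_cancel₀ _ (by norm_num)]
  refine ofReal_one_sub_le_toOuterMeasure_bind (le_trans (by positivity) hn)
    (G := {x | IsRepresentative D (positives f) (ENNReal.ofReal ε) (3 * releaseThreshold a c) x}) ?_
    fun x hx h hh => predictionError_le_of_mem_support hC hf ha hc hx hh
  rw [← hε]
  exact (iidSample_not_isRepresentative_le D (positives f) n _ (by positivity)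
    (by linarith)).trans (ENNReal.ofReal_le_ofReal hn)

end Sampling

section SampleSize

variable {ε δ α β : ℝ}

theorem log_two_le_log_one_div {t : ℝ} (ht0 : 0 < t) (ht : t ≤ 1 / 2) :
    Real.log 2 ≤ Real.log (1 / t) :=
  Real.log_le_log two_pos ((le_one_div two_pos ht0).2 ht)

theorem one_le_log_one_div_div (hα0 : 0 < α) (hα : α ≤ 1 / 2) (hβ0 : 0 < β) (hβ : β ≤ 1 / 2) :
    1 ≤ Real.log (1 / β) / α := by
  rw [one_le_div hα0]
  linarith [log_two_le_log_one_div hβ0 hβ, Real.log_two_gt_d9]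

theorem log_one_add_le_four_mul_log_one_div (hβ0 : 0 < β) (hβ : β ≤ 1 / 2) :
    Real.log (1 + 1 / (β / 5)) ≤ 4 * Real.log (1 / β) := by
  rw [one_div_div]
  have hβ2 : 2 ≤ 1 / β := (le_one_div two_pos hβ0).2 hβ
  have hpow : 1 + 5 / β ≤ (1 / β) ^ 4 :=
    calc 1 + 5 / β = 1 + 5 * (1 / β) := by ring
      _ ≤ 2 ^ 3 * (1 / β) := by linarith
      _ ≤ (1 / β) ^ 3 * (1 / β) := by gcongr
      _ = (1 / β) ^ 4 := by ring
  exact (Real.log_le_log (by positivity) hpow).trans_eq (by rw [Real.log_pow]; norm_num)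

theorem releaseThreshold_le (hα0 : 0 < α) (hα : α ≤ 1 / 2) (hβ0 : 0 < β) (hβ : β ≤ 1 / 2) :
    (releaseThreshold (α / 4) (β / 5) : ℝ) ≤ 35 * (Real.log (1 / β) / α) := by
  have hratio := one_le_log_one_div_div hα0 hα hβ0 hβ
  calc (releaseThreshold (α / 4) (β / 5) : ℝ)
      ≤ 2 + 2 * Real.log (1 + 1 / (β / 5)) / (α / 4) + 1 := by
        refine (Nat.ceil_lt_add_one ?_).le
        have : 0 ≤ Real.log (1 + 1 / (β / 5)) :=
          Real.log_nonneg (le_add_of_nonneg_right (by positivity))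
        positivity
    _ ≤ 2 + 2 * (4 * Real.log (1 / β)) / (α / 4) + 1 := by
        gcongr
        exact log_one_add_le_four_mul_log_one_div hβ0 hβ
    _ = 3 + 32 * (Real.log (1 / β) / α) := by
        field_simp
        ring
    _ ≤ 35 * (Real.log (1 / β) / α) := by linarith

theorem two_mul_two_pow_mul_exp_neg_le {k : ℕ} {u : ℝ} (hδ0 : 0 < δ) (hδ : δ ≤ 1 / 2)
    (hu : k + 2 * Real.log (1 / δ) ≤ u) : 2 * (2 ^ k * Real.exp (-u)) ≤ δ := by
  have htwo : (2 : ℝ) ≤ Real.exp 1 := by linarith [Real.add_one_le_exp (1 : ℝ)]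
  calc 2 * (2 ^ k * Real.exp (-u))
      ≤ 2 * (Real.exp 1 ^ k * Real.exp (-(k + 2 * Real.log (1 / δ)))) := by gcongr
    _ = 2 * Real.exp (2 * Real.log δ) := by
        rw [← Real.exp_nat_mul, ← Real.exp_add, one_div, Real.log_inv]
        ring_nf
    _ = 2 * δ * δ := by
        rw [two_mul (Real.log δ), Real.exp_add, Real.exp_log hδ0, mul_assoc]
    _ ≤ δ := mul_le_of_le_one_left hδ0.le (by linarith)

/-- The number of samples on which the learner for a linear class is run, with the accuracy
parameters `ε`, `δ` and the privacy parameters `α`, `β`. -/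
noncomputable def sampleSize (ε δ α β : ℝ) : ℕ :=
  ⌈18 * (releaseThreshold (α / 4) (β / 5) + Real.log (1 / δ)) / ε⌉₊

theorem two_mul_two_pow_mul_exp_neg_sampleSize_le (hε : 0 < ε) (hδ0 : 0 < δ) (hδ : δ ≤ 1 / 2) :
    2 * (2 ^ (3 * releaseThreshold (α / 4) (β / 5)) *
      Real.exp (-(sampleSize ε δ α β * (ε / 3) / 2))) ≤ δ := by
  have hlog : 0 < Real.log (1 / δ) :=
    (Real.log_pos one_lt_two).trans_le (log_two_le_log_one_div hδ0 hδ)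
  have hn : 18 * (releaseThreshold (α / 4) (β / 5) + Real.log (1 / δ)) / ε ≤
      sampleSize ε δ α β := Nat.le_ceil _
  rw [div_le_iff₀ hε] at hn
  refine two_mul_two_pow_mul_exp_neg_le hδ0 hδ ?_
  push_cast
  linarith

theorem sampleSize_le (hε0 : 0 < ε) (hε : ε ≤ 1 / 2) (hδ0 : 0 < δ) (hδ : δ ≤ 1 / 2) (hα0 : 0 < α)
    (hα : α ≤ 1 / 2) (hβ0 : 0 < β) (hβ : β ≤ 1 / 2) :
    (sampleSize ε δ α β : ℝ) ≤
      1280 * (1 / (ε * α) * Real.log (1 / β) * Real.log (1 / δ)) := by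
  have hT := releaseThreshold_le hα0 hα hβ0 hβ
  have hlogδ : 1 / 2 ≤ Real.log (1 / δ) := by
    linarith [log_two_le_log_one_div hδ0 hδ, Real.log_two_gt_d9]
  have hratio := one_le_log_one_div_div hα0 hα hβ0 hβ
  set Λ := Real.log (1 / β) / α with hΛ
  set M := Real.log (1 / δ)
  have hMΛ : M ≤ Λ * M := le_mul_of_one_le_left (by linarith) hratio
  have hΛM : Λ * (1 / 2) ≤ Λ * M := by gcongr
  calc (sampleSize ε δ α β : ℝ)
      ≤ 18 * (releaseThreshold (α / 4) (β / 5) + M) / ε + 1 :=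
        (Nat.ceil_lt_add_one (by positivity)).le
    _ = (18 * (releaseThreshold (α / 4) (β / 5) + M) + ε) / ε := by
        rw [add_div, div_self hε0.ne']
    _ ≤ 1280 * (Λ * M) / ε := by
        gcongr
        linarith
    _ = 1280 * (1 / (ε * α) * Real.log (1 / β) * M) := by
        rw [hΛ]
        field_simp

end SampleSize

theorem mainTheorem6_general :
    ∃ K : ℝ, 0 < K ∧
      ∀ {X : Type*} [Fintype X] (C : Set (X → Bool)), IsLinearClass C → ∀ ε δ α β : ℝ,
        ε ∈ Set.Ioo (0 : ℝ) (1 / 2) → δ ∈ Set.Ioo (0 : ℝ) (1 / 2) →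
        α ∈ Set.Ioo (0 : ℝ) (1 / 2) → β ∈ Set.Ioo (0 : ℝ) (1 / 2) →
        ∃ n : ℕ,
          (n : ℝ) ≤ K * (1 / (ε * α) * Real.log (1 / β) * Real.log (1 / δ)) ∧
          ∃ A : Learner X n, IsDifferentiallyPrivate α β A ∧ IsPACLearner ε δ C A := by
  refine ⟨1280, by norm_num, fun C hC ε δ α β ⟨hε0, hε⟩ ⟨hδ0, hδ⟩ ⟨hα0, hα⟩ ⟨hβ0, hβ⟩ =>
    ⟨sampleSize ε δ α β, sampleSize_le hε0 hε.le hδ0 hδ.le hα0 hα.le hβ0 hβ.le,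
      linearClassLearner C _ (α / 4) (β / 5), ?_, ?_⟩⟩
  · have hexp : Real.exp (2 * (α / 4)) ≤ 2 := by
      rw [← Real.le_log_iff_exp_le two_pos]
      linarith [Real.log_two_gt_d9]
    have hprivate := linearClassLearner_isDifferentiallyPrivate C (sampleSize ε δ α β)
      (by positivity) hexp (c := β / 5) (by positivity)
    rwa [mul_div_cancel₀ _ (by norm_num), mul_div_cancel₀ _ (by norm_num)] at hprivate
  · exact linearClassLearner_isPACLearner hC (by positivity) (by positivity) hε0 (by linarith)
      (two_mul_two_pow_mul_exp_neg_sampleSize_le hε0 hδ0 hδ.le)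

theorem isLinearClass_lineClass (p : ℕ) [Fact p.Prime] : IsLinearClass (LineClass p) := by
  rintro f ⟨a, b, hf⟩ g ⟨a', b', hg⟩ hne ⟨x, y⟩ ⟨hxf, hxg⟩ ⟨u, v⟩ ⟨huf, hug⟩
  have hx : a * x + b = y := (hf x y).1 hxf
  have hx' : a' * x + b' = y := (hg x y).1 hxg
  have hu : a * u + b = v := (hf u v).1 huf
  have hu' : a' * u + b' = v := (hg u v).1 hug
  have hslope : a ≠ a' := by
    rintro rfl
    obtain rfl : b = b' := add_left_cancel (hx.trans hx'.symm)
    exact hne (funext fun z => Bool.eq_iff_iff.2 ((hf z.1 z.2).trans (hg z.1 z.2).symm))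
  have hxu : x = u := by
    have : (a - a') * (x - u) = 0 := by linear_combination hx - hx' - hu + hu'
    exact sub_eq_zero.1 ((mul_eq_zero.1 this).resolve_left (sub_ne_zero.2 hslope))
  rw [Prod.mk.injEq]
  exact ⟨hxu, by rw [← hx, ← hu, hxu]⟩

theorem mainTheorem6 :
    ∃ K : ℝ, 0 < K ∧
      ∀ (p : ℕ) [Fact p.Prime] (ε δ α β : ℝ),
        ε ∈ Set.Ioo (0 : ℝ) (1 / 2) → δ ∈ Set.Ioo (0 : ℝ) (1 / 2) →
        α ∈ Set.Ioo (0 : ℝ) (1 / 2) → β ∈ Set.Ioo (0 : ℝ) (1 / 2) →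
        ∃ n : ℕ,
          (n : ℝ) ≤ K * (1 / (ε * α) * Real.log (1 / β) * Real.log (1 / δ)) ∧
          ∃ A : Learner (ZMod p × ZMod p) n,
            IsDifferentiallyPrivate α β A ∧ IsPACLearner ε δ (LineClass p) A := by
  obtain ⟨K, hK, hlearn⟩ := mainTheorem6_general
  exact ⟨K, hK, fun p _ => hlearn (LineClass p) (isLinearClass_lineClass p)⟩
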